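/- A $C^\infty$-ring is a product-preserving functor from the category of the spaces $\mathbb R^n$ and smooth maps to sets, and the category of $C^\infty$-schemes is the opposite of the category of $C^\infty$-rings; $C^\infty(X)$ denotes the $C^\infty$-ring of a $C^\infty$-scheme $X$, $\mathrm{Spec}(A)$ the $C^\infty$-scheme of a $C^\infty$-ring $A$, and $\underline{X}=\mathrm{Hom}(-,X)$ the representable presheaf of sets. For an ideal $I$ of a $C^\infty$-ring $A$, let $\sqrt[\mathrm{nil}]{I}=\{f\in A : f^k\in I\text{ for some }k\ge 1\}$ be its nilradical, and let $\sqrt[\infty]{I}=\{f\in A : (A/I)\{f^{-1}\}\cong 0\}$ be its $\infty$-radical, where the localization is taken in $C^\infty$-rings. Let $\mathrm{red}_n(A)=A/\sqrt[\mathrm{nil}]{0}$ and $\mathrm{red}_\infty(A)=A/\sqrt[\infty]{0}$, with the projections $A\to\mathrm{red}_n(A)$ and $A\to\mathrm{red}_\infty(A)$. A $C^\infty$-scheme $X$ is $\mathrm{red}_n$-injective (resp. $\mathrm{red}_\infty$-injective) if, for every $C^\infty$-ring $R$, every morphism $C^\infty(X)\to\mathrm{red}_n(R)$ (resp. $C^\infty(X)\to\mathrm{red}_\infty(R)$)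 lifts along the projection from $R$. Let $X$ be a $C^\infty$-scheme, and let $\mathfrak m_\Delta$ be the kernel of the codiagonal $C^\infty(X\times X)\to C^\infty(X)$, i.e. the ideal of the diagonal. Define the presheaves on $C^\infty$-schemes $$N_{\mathrm{nil}}=\operatorname*{colim}_{I:\ \sqrt[\mathrm{nil}]{I}=\sqrt[\mathrm{nil}]{\mathfrak m_\Delta}}\underline{\mathrm{Spec}(C^\infty(X\times X)/I)},\qquad N_\infty=\operatorname*{colim}_{I:\ \sqrt[\infty]{I}=\sqrt[\infty]{\mathfrak m_\Delta}}\underline{\mathrm{Spec}(C^\infty(X\times X)/I)},$$ where $I$ ranges over ideals of $C^\infty(X\times X)$, the transition maps are given by the inclusions of ideals, and the colimits are taken in presheaves of sets. The two projections $X\times X\rightrightarrows X$ induce morphisms $N_{\mathrm{nil}}\rightrightarrows\underline X$ and $N_\infty\rightrightarrows\underline X$. 1. If $X$ is $\mathrm{red}_n$-injective, then the canonical morphism $\underline X\to\underline X\circ\mathrm{red}_n$ to the nilpotent de Rham space of $X$ is a coequalizer of $N_{\mathrm{nil}}\rightrightarrows\underline X$ in presheaves of sets. 2. If $X$ is $\mathrm{red}_\infty$-injective,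 then the canonical morphism $\underline X\to\underline X\circ\mathrm{red}_\infty$ to the $\infty$-de Rham space of $X$ is a coequalizer of $N_\infty\rightrightarrows\underline X$ in presheaves of sets. -/

import Mathlib

open scoped ContDiff

universe u v w

/-! # Smooth functions on Euclidean spaces -/

/-- The algebra `C^∞(ℝⁿ)` of smooth functions `ℝⁿ → ℝ`, with pointwise operations. -/
def smoothFunctions (n : ℕ) : Subalgebra ℝ ((Fin n → ℝ) → ℝ) where
  carrier := {f | ContDiff ℝ ∞ f}
  mul_mem' {f g} (hf : ContDiff ℝ ∞ f) (hg : ContDiff ℝ ∞ g) :=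
    show ContDiff ℝ ∞ (f * g) from hf.mul hg
  add_mem' {f g} (hf : ContDiff ℝ ∞ f) (hg : ContDiff ℝ ∞ g) :=
    show ContDiff ℝ ∞ (f + g) from hf.add hg
  algebraMap_mem' r := show ContDiff ℝ ∞ (fun _ : Fin n → ℝ => r) from contDiff_const

/-- A smooth function `ℝⁿ → ℝ`. -/
abbrev Smooth (n : ℕ) : Type := smoothFunctions n

namespace Smooth

theorem contDiff {n : ℕ} (f : Smooth n) : ContDiff ℝ ∞ f.1 := f.2

/-- The `i`-th coordinate function. -/
def proj {n : ℕ} (i : Fin n) : Smooth n := 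
  ⟨fun x => x i, show ContDiff ℝ ∞ fun x : Fin n → ℝ => x i from contDiff_apply ℝ ℝ i⟩

/-- The composite `f(g₁, …, gₙ)`. -/
def comp {n m : ℕ} (f : Smooth n) (g : Fin n → Smooth m) : Smooth m :=
  ⟨fun x => f.1 fun i => (g i).1 x, show ContDiff ℝ ∞ fun x => f.1 fun i => (g i).1 x from
    f.contDiff.comp (contDiff_pi.2 fun i => (g i).contDiff)⟩

/-- The function `ℝ² → ℝ`, `(x, y) ↦ x + y`. -/
def addFn : Smooth 2 := proj 0 + proj 1

/-- The function `ℝ² → ℝ`, `(x, y) ↦ x * y`. -/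
def mulFn : Smooth 2 := proj 0 * proj 1

theorem comp_proj {n : ℕ} (f : Smooth n) : comp f proj = f := rfl

theorem proj_comp {n m : ℕ} (i : Fin n) (g : Fin n → Smooth m) : comp (proj i) g = g i := rfl

theorem comp_comp {n m k : ℕ} (f : Smooth n) (g : Fin n → Smooth m) (h : Fin m → Smooth k) :
    comp (comp f g) h = comp f fun i => comp (g i) h := rfl

theorem comp_addFn {n : ℕ} (g : Fin 2 → Smooth n) : comp addFn g = g 0 + g 1 := rfl

theorem comp_mulFn {n : ℕ} (g : Fin 2 → Smooth n) : comp mulFn g = g 0 * g 1 := rfl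

theorem contDiff_integral {E : Type} [NormedAddCommGroup E] [NormedSpace ℝ E]
    [FiniteDimensional ℝ E] (n : ℕ) :
    ∀ {F : Type} [NormedAddCommGroup F] [NormedSpace ℝ F]
      (H : E × ℝ → F), ContDiff ℝ n H → ContDiff ℝ n fun x => ∫ t in (0:ℝ)..1, H (x, t) := by
  induction n with
  | zero =>
    intro F _ _ H hH
    have hc : Continuous H := hH.continuous
    exact contDiff_zero.2
      (intervalIntegral.continuous_parametric_intervalIntegral_of_continuous' (by exact hc) 0 1)
  | succ n ih =>
    intro F _ _ H hH
    have hH' : ContDiff ℝ n (fderiv ℝ H) := by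
      have := hH.fderiv_right (m := n) (by simp)
      exact this
    have hc : Continuous H := hH.continuous
    have hd : Differentiable ℝ H := hH.differentiable (by simp)
    let D : E × ℝ → (E →L[ℝ] F) := fun p => (fderiv ℝ H p).comp (ContinuousLinearMap.inl ℝ E ℝ)
    have hD : ContDiff ℝ n D := hH'.clm_comp contDiff_const
    have hDc : Continuous D := hD.continuous
    have hder : ∀ x t, HasFDerivAt (fun y => H (y, t)) (D (x, t)) x := fun x t =>
      (hd (x, t)).hasFDerivAt.comp x (hasFDerivAt_prodMk_left x t)
    rw [Nat.cast_succ, contDiff_succ_iff_hasFDerivAt]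
    refine ⟨_, ih D hD, fun x => ?_⟩
    obtain ⟨C, hC⟩ := ((isCompact_closedBall x 1).prod (isCompact_Icc (a := (0:ℝ)) (b := 1))
      ).exists_bound_of_continuousOn hDc.continuousOn
    refine (intervalIntegral.hasFDerivAt_integral_of_dominated_of_fderiv_le
      (F := fun x t => H (x, t)) (F' := fun x t => D (x, t)) (bound := fun _ => C)
      (Metric.ball_mem_nhds x one_pos) ?_ ?_ ?_ ?_ ?_ ?_)
    · exact .of_forall fun y => (by fun_prop : Continuous fun t => H (y, t)).aestronglyMeasurable
    · exact (by fun_prop : Continuous fun t => H (x, t)).intervalIntegrable _ _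
    · exact (by fun_prop : Continuous fun t => D (x, t)).aestronglyMeasurable
    · refine .of_forall fun t ht y hy => hC (y, t) ⟨Metric.ball_subset_closedBall hy, ?_⟩
      rw [Set.uIoc_of_le zero_le_one] at ht
      exact ⟨ht.1.le, ht.2⟩
    · exact intervalIntegrable_const
    · exact .of_forall fun t _ y _ => hder y t

/-- Hadamard's lemma: `f(x) - f(y) = ∑ᵢ (xᵢ - yᵢ) gᵢ(x, y)` with smooth `gᵢ`. -/
theorem hadamard {n : ℕ} (f : Smooth n) : ∃ g : Fin n → Smooth (n + n),
    comp f (fun i => proj (Fin.castAdd n i)) - comp f (fun i => proj (Fin.natAdd n i)) =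
      ∑ i, (proj (Fin.castAdd n i) - proj (Fin.natAdd n i)) * g i := by
  have hf : ContDiff ℝ ∞ f.1 := f.2
  let X : (Fin (n + n) → ℝ) → (Fin n → ℝ) := fun v i => v (Fin.castAdd n i)
  let Y : (Fin (n + n) → ℝ) → (Fin n → ℝ) := fun v i => v (Fin.natAdd n i)
  have hX : ContDiff ℝ ∞ X := contDiff_pi.2 fun i => contDiff_apply ℝ ℝ _
  have hY : ContDiff ℝ ∞ Y := contDiff_pi.2 fun i => contDiff_apply ℝ ℝ _
  let H : Fin n → (Fin (n + n) → ℝ) × ℝ → ℝ := fun i p =>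
    fderiv ℝ f.1 (Y p.1 + p.2 • (X p.1 - Y p.1)) (Pi.single i 1)
  have hH : ∀ i, ContDiff ℝ ∞ (H i) := fun i => by
    have h1 : ContDiff ℝ ∞ (fderiv ℝ f.1) := (contDiff_infty_iff_fderiv.1 hf).2
    have h2 : ContDiff ℝ ∞ fun p : (Fin (n + n) → ℝ) × ℝ =>
        Y p.1 + p.2 • (X p.1 - Y p.1) := by fun_prop
    exact (h1.comp h2).clm_apply contDiff_const
  refine ⟨fun i => ⟨fun v => ∫ t in (0:ℝ)..1, H i (v, t), contDiff_infty.2 fun k =>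
    contDiff_integral k (H i) ((hH i).of_le (by exact_mod_cast le_top))⟩, ?_⟩
  apply Subtype.ext
  funext v
  have hd : Differentiable ℝ f.1 := hf.differentiable (by simp)
  have hseg : ∀ t : ℝ, HasDerivAt (fun s : ℝ => f.1 (Y v + s • (X v - Y v)))
      (fderiv ℝ f.1 (Y v + t • (X v - Y v)) (X v - Y v)) t := fun t => by
    have h := ((hasDerivAt_id t).smul_const (X v - Y v)).const_add (Y v)
    have := (hd (Y v + t • (X v - Y v))).hasFDerivAt.comp_hasDerivAt t h
    rw [one_smul] at this
    exact this
  have hexp : ∀ t : ℝ, fderiv ℝ f.1 (Y v + t • (X v - Y v)) (X v - Y v) =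
      ∑ i, (X v i - Y v i) * H i (v, t) := fun t => by
    have key : ∀ (L : (Fin n → ℝ) →L[ℝ] ℝ) (w : Fin n → ℝ),
        L w = ∑ i, w i * L (Pi.single i 1) := fun L w => by
      conv_lhs => rw [← Finset.univ_sum_single w, map_sum]
      refine Finset.sum_congr rfl fun i _ => ?_
      rw [← smul_eq_mul, ← map_smul, ← Pi.single_smul, smul_eq_mul, mul_one]
    exact key _ _
  have hHc : ∀ i, Continuous fun t : ℝ => H i (v, t) := fun i =>
    (hH i).continuous.comp (by fun_prop)
  have hint := intervalIntegral.integral_eq_sub_of_hasDerivAt (a := 0) (b := 1)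
    (fun t _ => hseg t) (by
      simp_rw [hexp]
      exact (continuous_finsetSum _ fun i _ =>
        continuous_const.mul (hHc i)).intervalIntegrable _ _)
  simp_rw [hexp] at hint
  rw [intervalIntegral.integral_finsetSum (f := fun i t => (X v i - Y v i) * H i (v, t))
    (fun i _ => (continuous_const.mul (hHc i)).intervalIntegrable _ _)] at hint
  simp only [intervalIntegral.integral_const_mul, one_smul, zero_smul, add_zero,
    add_sub_cancel] at hint
  have : (∑ i, (proj (Fin.castAdd n i) - proj (Fin.natAdd n i)) *
      (⟨fun v => ∫ t in (0:ℝ)..1, H i (v, t), contDiff_infty.2 fun k =>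
    contDiff_integral k (H i) ((hH i).of_le (by exact_mod_cast le_top))⟩ : Smooth (n + n))).1 v
      = ∑ i, (X v i - Y v i) * ∫ t in (0:ℝ)..1, H i (v, t) := by
    rw [AddSubmonoidClass.coe_finsetSum, Finset.sum_apply]
    rfl
  rw [this, hint]
  rfl

end Smooth

/-! # `C^∞`-rings -/

/-- A `C^∞`-ring: a set `A` with an operation `Aⁿ → A` for every smooth function `ℝⁿ → ℝ`,
respecting projections and composition (so that `ℝⁿ ↦ Aⁿ` is a product preserving functor on the
category of Euclidean spaces and smooth maps). The commutative ring structure is the one given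
by the operations of the smooth functions `x + y` and `x * y`. -/
class CInftyRing (A : Type u) extends CommRing A where
  /-- The operation of a smooth function. -/
  op : ∀ {n : ℕ}, Smooth n → (Fin n → A) → A
  op_proj : ∀ {n : ℕ} (i : Fin n) (a : Fin n → A), op (Smooth.proj i) a = a i
  op_comp : ∀ {n m : ℕ} (f : Smooth n) (g : Fin n → Smooth m) (a : Fin m → A),
    op (Smooth.comp f g) a = op f fun i => op (g i) a
  op_addFn : ∀ a : Fin 2 → A, op Smooth.addFn a = a 0 + a 1
  op_mulFn : ∀ a : Fin 2 → A, op Smooth.mulFn a = a 0 * a 1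

namespace CInftyRing

/-- A set with operations respecting projections and composition is a `C^∞`-ring, the ring
structure being induced by the operations. -/
@[reducible] def ofOps {A : Type u} (op : ∀ {n : ℕ}, Smooth n → (Fin n → A) → A)
    (op_proj : ∀ {n : ℕ} (i : Fin n) (a : Fin n → A), op (Smooth.proj i) a = a i)
    (op_comp : ∀ {n m : ℕ} (f : Smooth n) (g : Fin n → Smooth m) (a : Fin m → A),
      op (Smooth.comp f g) a = op f fun i => op (g i) a) : CInftyRing A :=
  letI ringData : Add A × Mul A × Neg A × Zero A × One A :=
    ⟨⟨fun a b => op Smooth.addFn ![a, b]⟩, ⟨fun a b => op Smooth.mulFn ![a, b]⟩,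
      ⟨fun a => op (-Smooth.proj 0) ![a]⟩, ⟨op (0 : Smooth 0) ![]⟩, ⟨op (1 : Smooth 0) ![]⟩⟩
  letI : Add A := ringData.1
  letI : Mul A := ringData.2.1
  letI : Neg A := ringData.2.2.1
  letI : Zero A := ringData.2.2.2.1
  letI : One A := ringData.2.2.2.2
  have op_add : ∀ {n : ℕ} (f g : Smooth n) (a : Fin n → A), op (f + g) a = op f a + op g a :=
    fun f g a => by
      rw [show f + g = Smooth.comp Smooth.addFn ![f, g] from rfl, op_comp]
      exact congrArg (op Smooth.addFn) (funext fun i => by fin_cases i <;> rfl)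
  have op_mul : ∀ {n : ℕ} (f g : Smooth n) (a : Fin n → A), op (f * g) a = op f a * op g a :=
    fun f g a => by
      rw [show f * g = Smooth.comp Smooth.mulFn ![f, g] from rfl, op_comp]
      exact congrArg (op Smooth.mulFn) (funext fun i => by fin_cases i <;> rfl)
  have op_neg : ∀ {n : ℕ} (f : Smooth n) (a : Fin n → A), op (-f) a = -op f a :=
    fun f a => by
      rw [show -f = Smooth.comp (-Smooth.proj 0) ![f] from rfl, op_comp]
      exact congrArg (op (-Smooth.proj 0)) (funext fun i => by fin_cases i; rfl)
  have op_zero : ∀ {n : ℕ} (a : Fin n → A), op (0 : Smooth n) a = 0 :=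
    fun {n} a => by
      rw [show (0 : Smooth n) = Smooth.comp (0 : Smooth 0) ![] from rfl, op_comp]
      exact congrArg (op (0 : Smooth 0)) (funext fun i => i.elim0)
  have op_one : ∀ {n : ℕ} (a : Fin n → A), op (1 : Smooth n) a = 1 :=
    fun {n} a => by
      rw [show (1 : Smooth n) = Smooth.comp (1 : Smooth 0) ![] from rfl, op_comp]
      exact congrArg (op (1 : Smooth 0)) (funext fun i => i.elim0)
  have three : ∀ (P : A → A → A → Prop),
      (∀ t : Fin 3 → A, P (op (Smooth.proj 0) t) (op (Smooth.proj 1) t) (op (Smooth.proj 2) t)) →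
        ∀ a b c, P a b c := fun P h a b c => by
    have := h ![a, b, c]
    rwa [op_proj, op_proj, op_proj] at this
  { add := (· + ·)
    mul := (· * ·)
    neg := (- ·)
    zero := 0
    one := 1
    nsmul := nsmulRec
    zsmul := zsmulRec
    add_assoc := three _ fun t => by simp only [← op_add]; rw [add_assoc]
    zero_add := fun a => three (fun a _ _ => 0 + a = a)
      (fun t => by rw [← op_zero t, ← op_add, zero_add]) a a a
    add_zero := fun a => three (fun a _ _ => a + 0 = a)
      (fun t => by rw [← op_zero t, ← op_add, add_zero]) a a a
    add_comm := fun a b => three (fun a b _ => a + b = b + a)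
      (fun t => by simp only [← op_add]; rw [add_comm]) a b a
    neg_add_cancel := fun a => three (fun a _ _ => -a + a = 0)
      (fun t => by rw [← op_zero t, ← op_neg, ← op_add, neg_add_cancel]) a a a
    mul_assoc := three _ fun t => by simp only [← op_mul]; rw [mul_assoc]
    one_mul := fun a => three (fun a _ _ => 1 * a = a)
      (fun t => by rw [← op_one t, ← op_mul, one_mul]) a a a
    mul_one := fun a => three (fun a _ _ => a * 1 = a)
      (fun t => by rw [← op_one t, ← op_mul, mul_one]) a a a
    mul_comm := fun a b => three (fun a b _ => a * b = b * a)
      (fun t => by simp only [← op_mul]; rw [mul_comm]) a b a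
    zero_mul := fun a => three (fun a _ _ => 0 * a = 0)
      (fun t => by rw [← op_zero t, ← op_mul, zero_mul]) a a a
    mul_zero := fun a => three (fun a _ _ => a * 0 = 0)
      (fun t => by rw [← op_zero t, ← op_mul, mul_zero]) a a a
    left_distrib := three _ fun t => by simp only [← op_mul, ← op_add]; rw [mul_add]
    right_distrib := three _ fun t => by simp only [← op_mul, ← op_add]; rw [add_mul]
    op := op
    op_proj := op_proj
    op_comp := op_comp
    op_addFn := fun a => congrArg (op Smooth.addFn) (funext fun i => by fin_cases i <;> rfl)
    op_mulFn := fun a => congrArg (op Smooth.mulFn) (funext fun i => by fin_cases i <;> rfl) }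

variable {A : Type u} [CInftyRing A]

theorem op_add {n : ℕ} (f g : Smooth n) (a : Fin n → A) : op (f + g) a = op f a + op g a := by
  have := op_comp Smooth.addFn ![f, g] a
  rwa [op_addFn] at this

theorem op_mul {n : ℕ} (f g : Smooth n) (a : Fin n → A) : op (f * g) a = op f a * op g a := by
  have := op_comp Smooth.mulFn ![f, g] a
  rwa [op_mulFn] at this

theorem op_zero {n : ℕ} (a : Fin n → A) : op (0 : Smooth n) a = 0 := by
  have := op_add (0 : Smooth n) 0 a
  rw [add_zero] at this
  exact left_eq_add.1 this

theorem op_one {n : ℕ} (a : Fin n → A) : op (1 : Smooth n) a = 1 := by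
  have key : ∀ b : A, op (1 : Smooth 1) ![b] * b = b := fun b => by
    have := op_mul (1 : Smooth 1) (Smooth.proj 0) ![b]
    rw [one_mul, op_proj] at this
    exact this.symm
  have h0 : ∀ (m : ℕ) (b : Fin m → A), op (1 : Smooth m) b = op (1 : Smooth 0) ![] := fun m b => by
    rw [show (1 : Smooth m) = Smooth.comp (1 : Smooth 0) ![] from rfl, op_comp]
    exact congrArg (op (1 : Smooth 0)) (funext fun i => i.elim0)
  have := key 1
  rwa [mul_one, h0, ← h0 n a] at this

/-- Evaluation of smooth functions at a tuple of elements of a `C^∞`-ring. -/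
def eval {n : ℕ} (a : Fin n → A) : Smooth n →+* A where
  toFun f := op f a
  map_one' := op_one a
  map_mul' f g := op_mul f g a
  map_zero' := op_zero a
  map_add' f g := op_add f g a

theorem op_sub_mem (I : Ideal A) {n : ℕ} (f : Smooth n) (a b : Fin n → A)
    (h : ∀ i, a i - b i ∈ I) : op f a - op f b ∈ I := by
  obtain ⟨g, hg⟩ := Smooth.hadamard f
  have := congrArg (eval (Fin.append a b)) hg
  rw [map_sub, map_sum] at this
  simp only [map_mul, map_sub] at this
  simp only [eval, RingHom.coe_mk, MonoidHom.coe_mk, OneHom.coe_mk, op_comp, op_proj,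
    Fin.append_left, Fin.append_right] at this
  rw [this]
  exact I.sum_mem fun i _ => I.mul_mem_right _ (h i)

/-- The quotient of a `C^∞`-ring by an ideal. -/
noncomputable instance quotient (I : Ideal A) : CInftyRing (A ⧸ I) where
  op f q := Ideal.Quotient.mk I (op f fun i => (q i).out)
  op_proj i q := by rw [op_proj]; exact Quotient.out_eq _
  op_comp f g q := by
    rw [op_comp]
    refine Ideal.Quotient.eq.2 (op_sub_mem I _ _ _ fun i => Ideal.Quotient.eq.1 ?_)
    exact (Quotient.out_eq _).symm
  op_addFn q := by
    rw [op_addFn, map_add]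
    exact congrArg₂ _ (Quotient.out_eq _) (Quotient.out_eq _)
  op_mulFn q := by
    rw [op_mulFn, map_mul]
    exact congrArg₂ _ (Quotient.out_eq _) (Quotient.out_eq _)

theorem op_mk (I : Ideal A) {n : ℕ} (f : Smooth n) (a : Fin n → A) :
    op f (fun i => Ideal.Quotient.mk I (a i)) = Ideal.Quotient.mk I (op f a) :=
  Ideal.Quotient.eq.2 (op_sub_mem I _ _ _ fun _ => Ideal.Quotient.eq.1 (Quotient.out_eq _))

/-- `C^∞(ℝⁿ)` is a `C^∞`-ring, with operations given by composition. -/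
instance smooth (n : ℕ) : CInftyRing (Smooth n) where
  op f g := Smooth.comp f g
  op_proj _ _ := rfl
  op_comp _ _ _ := rfl
  op_addFn _ := rfl
  op_mulFn _ := rfl

end CInftyRing

/-! # Morphisms -/

/-- A morphism of `C^∞`-rings: a map commuting with the operations of all smooth functions. -/
@[ext] structure CInftyRingHom (A : Type u) (B : Type v) [CInftyRing A] [CInftyRing B] where
  /-- The underlying map. -/
  toFun : A → B
  map_op : ∀ {n : ℕ} (f : Smooth n) (a : Fin n → A),
    toFun (CInftyRing.op f a) = CInftyRing.op f fun i => toFun (a i)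

namespace CInftyRingHom

open CInftyRing

variable {A : Type u} {B : Type v} {C : Type w} [CInftyRing A] [CInftyRing B] [CInftyRing C]

/-- The identity morphism. -/
def id (A : Type u) [CInftyRing A] : CInftyRingHom A A := ⟨fun a => a, fun _ _ => rfl⟩

/-- The composite of two morphisms (first `φ`, then `ψ`). -/
def comp (ψ : CInftyRingHom B C) (φ : CInftyRingHom A B) : CInftyRingHom A C :=
  ⟨fun a => ψ.toFun (φ.toFun a), fun f a => by rw [φ.map_op, ψ.map_op]⟩

/-- The homomorphism of commutative rings underlying a morphism of `C^∞`-rings. -/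
def toRingHom (φ : CInftyRingHom A B) : A →+* B where
  toFun := φ.toFun
  map_one' := by
    have := φ.map_op (1 : Smooth 0) ![]
    rwa [op_one, op_one] at this
  map_zero' := by
    have := φ.map_op (0 : Smooth 0) ![]
    rwa [op_zero, op_zero] at this
  map_mul' a b := by
    have := φ.map_op Smooth.mulFn ![a, b]
    rwa [op_mulFn, op_mulFn] at this
  map_add' a b := by
    have := φ.map_op Smooth.addFn ![a, b]
    rwa [op_addFn, op_addFn] at this

/-- The projection onto a quotient. -/
noncomputable def quotientMk (I : Ideal A) : CInftyRingHom A (A ⧸ I) :=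
  ⟨Ideal.Quotient.mk I, fun f a => (op_mk I f a).symm⟩

/-- A morphism which kills an ideal factors through the quotient. -/
noncomputable def lift (I : Ideal A) (φ : CInftyRingHom A B) (h : I ≤ RingHom.ker φ.toRingHom) :
    CInftyRingHom (A ⧸ I) B :=
  ⟨Ideal.Quotient.lift I φ.toRingHom fun _ ha => h ha, fun f q => by
    obtain ⟨a, rfl⟩ : ∃ a : _ → A, q = fun i => Ideal.Quotient.mk I (a i) :=
      ⟨fun i => (q i).out, funext fun i => (Quotient.out_eq (q i)).symm⟩
    rw [op_mk]
    exact φ.map_op f a⟩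

/-- The morphism `A/I → B/J` induced by a morphism `φ : A → B` with `φ(I) ⊆ J`. -/
noncomputable def quotientMap (I : Ideal A) (J : Ideal B) (φ : CInftyRingHom A B)
    (h : I ≤ J.comap φ.toRingHom) : CInftyRingHom (A ⧸ I) (B ⧸ J) :=
  lift I ((quotientMk J).comp φ) fun a ha => show Ideal.Quotient.mk J (φ.toFun a) = 0 from
    Ideal.Quotient.eq_zero_iff_mem.2 (h ha)

theorem quotient_ext {I : Ideal A} {φ ψ : CInftyRingHom (A ⧸ I) B}
    (h : ∀ a, φ.toFun (Ideal.Quotient.mk I a) = ψ.toFun (Ideal.Quotient.mk I a)) : φ = ψ :=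
  CInftyRingHom.ext (funext fun q => by
    obtain ⟨a, rfl⟩ := Ideal.Quotient.mk_surjective q
    exact h a)

/-- The morphism `C^∞(ℝⁿ) → A` that sends the coordinates to given elements of `A`. -/
def eval {n : ℕ} (a : Fin n → A) : CInftyRingHom (Smooth n) A :=
  ⟨fun f => op f a, fun f g => op_comp f g a⟩

end CInftyRingHom

/-! # Coproducts -/

/-- Formal expressions built from elements of `A` and of `B` by the operations of the smooth
functions. -/
inductive CoprodTerm (A : Type u) (B : Type v) : Type (max u v)
  | inl : A → CoprodTerm A B
  | inr : B → CoprodTerm A B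
  | op : {n : ℕ} → Smooth n → (Fin n → CoprodTerm A B) → CoprodTerm A B

/-- The congruence on formal expressions generated by the axioms of `C^∞`-rings and by the
requirement that `A` and `B` map homomorphically. -/
inductive CoprodRel (A : Type u) (B : Type v) [CInftyRing A] [CInftyRing B] :
    CoprodTerm A B → CoprodTerm A B → Prop
  | refl (s) : CoprodRel A B s s
  | symm {s t} : CoprodRel A B s t → CoprodRel A B t s
  | trans {s t r} : CoprodRel A B s t → CoprodRel A B t r → CoprodRel A B s r
  | congr {n : ℕ} (f : Smooth n) (s t : Fin n → CoprodTerm A B) :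
      (∀ i, CoprodRel A B (s i) (t i)) → CoprodRel A B (.op f s) (.op f t)
  | proj {n : ℕ} (i : Fin n) (s : Fin n → CoprodTerm A B) :
      CoprodRel A B (.op (Smooth.proj i) s) (s i)
  | comp {n m : ℕ} (f : Smooth n) (g : Fin n → Smooth m) (s : Fin m → CoprodTerm A B) :
      CoprodRel A B (.op (Smooth.comp f g) s) (.op f fun i => .op (g i) s)
  | inl {n : ℕ} (f : Smooth n) (a : Fin n → A) :
      CoprodRel A B (.inl (CInftyRing.op f a)) (.op f fun i => .inl (a i))
  | inr {n : ℕ} (f : Smooth n) (b : Fin n → B) :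
      CoprodRel A B (.inr (CInftyRing.op f b)) (.op f fun i => .inr (b i))

/-- The setoid of `CoprodRel`. -/
def coprodSetoid (A : Type u) (B : Type v) [CInftyRing A] [CInftyRing B] :
    Setoid (CoprodTerm A B) :=
  ⟨CoprodRel A B, .refl, .symm, .trans⟩

/-- The coproduct `A ⊗_∞ B` of two `C^∞`-rings. -/
def CInftyCoprod (A : Type u) (B : Type v) [CInftyRing A] [CInftyRing B] : Type (max u v) :=
  Quotient (coprodSetoid A B)

namespace CInftyCoprod

open CInftyRing

section

variable (A : Type u) (B : Type v) [CInftyRing A] [CInftyRing B]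

/-- The class of a formal expression. -/
def mk : CoprodTerm A B → CInftyCoprod A B := Quotient.mk (coprodSetoid A B)

variable {A B}

theorem mk_eq {s t : CoprodTerm A B} (h : CoprodRel A B s t) : mk A B s = mk A B t :=
  Quotient.sound (s := coprodSetoid A B) h

theorem mk_out (q : CInftyCoprod A B) : mk A B (Quotient.out q) = q := Quotient.out_eq q

theorem out_mk (s : CoprodTerm A B) : CoprodRel A B (Quotient.out (mk A B s)) s :=
  Quotient.mk_out (s := coprodSetoid A B) s

noncomputable instance : CInftyRing (CInftyCoprod A B) :=
  ofOps (fun f q => mk A B (.op f fun i => Quotient.out (q i)))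
    (fun i q => (mk_eq (.proj i _)).trans (mk_out (q i)))
    (fun f g _ => mk_eq ((CoprodRel.comp f g _).trans (.congr f _ _ fun _ => .symm (out_mk _))))

theorem op_mk {n : ℕ} (f : Smooth n) (s : Fin n → CoprodTerm A B) :
    op f (fun i => mk A B (s i)) = mk A B (.op f s) :=
  mk_eq (.congr f _ _ fun _ => out_mk _)

variable (A B)

/-- The first coprojection `A → A ⊗_∞ B`. -/
noncomputable def inl : CInftyRingHom A (CInftyCoprod A B) :=
  ⟨fun a => mk A B (.inl a), fun f a => (mk_eq (.inl f a)).trans (op_mk f _).symm⟩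

/-- The second coprojection `B → A ⊗_∞ B`. -/
noncomputable def inr : CInftyRingHom B (CInftyCoprod A B) :=
  ⟨fun b => mk A B (.inr b), fun f b => (mk_eq (.inr f b)).trans (op_mk f _).symm⟩

end

variable {A : Type u} {B : Type v} {C : Type w} [CInftyRing A] [CInftyRing B] [CInftyRing C]

/-- The value of a formal expression under a pair of morphisms. -/
def termValue (φ : CInftyRingHom A C) (ψ : CInftyRingHom B C) : CoprodTerm A B → C
  | .inl a => φ.toFun a
  | .inr b => ψ.toFun b
  | .op f s => op f fun i => termValue φ ψ (s i)

theorem termValue_rel (φ : CInftyRingHom A C) (ψ : CInftyRingHom B C) {s t : CoprodTerm A B}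
    (h : CoprodRel A B s t) : termValue φ ψ s = termValue φ ψ t := by
  induction h with
  | refl => rfl
  | symm _ ih => exact ih.symm
  | trans _ _ ih ih' => exact ih.trans ih'
  | congr f s t _ ih => exact congrArg (op f) (funext ih)
  | proj i s => exact op_proj i _
  | comp f g s => exact op_comp f g _
  | inl f a => exact φ.map_op f a
  | inr f b => exact ψ.map_op f b

/-- The morphism `A ⊗_∞ B → C` given by morphisms `A → C` and `B → C`. -/
noncomputable def desc (φ : CInftyRingHom A C) (ψ : CInftyRingHom B C) :
    CInftyRingHom (CInftyCoprod A B) C :=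
  ⟨Quotient.lift (s := coprodSetoid A B) (termValue φ ψ) fun _ _ h => termValue_rel φ ψ h,
    fun f q => by
      obtain ⟨s, rfl⟩ : ∃ s : _ → CoprodTerm A B, q = fun i => mk A B (s i) :=
        ⟨fun i => Quotient.out (q i), funext fun i => (mk_out (q i)).symm⟩
      rw [op_mk]
      rfl⟩

theorem desc_inl (φ : CInftyRingHom A C) (ψ : CInftyRingHom B C) :
    (desc φ ψ).comp (inl A B) = φ := rfl

theorem desc_inr (φ : CInftyRingHom A C) (ψ : CInftyRingHom B C) :
    (desc φ ψ).comp (inr A B) = ψ := rfl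

theorem hom_ext {φ ψ : CInftyRingHom (CInftyCoprod A B) C}
    (hl : φ.comp (inl A B) = ψ.comp (inl A B)) (hr : φ.comp (inr A B) = ψ.comp (inr A B)) :
    φ = ψ := by
  refine CInftyRingHom.ext (funext fun q => ?_)
  obtain ⟨s, rfl⟩ : ∃ s, q = mk A B s := ⟨Quotient.out q, (mk_out q).symm⟩
  induction s with
  | inl a => exact congrFun (congrArg CInftyRingHom.toFun hl) a
  | inr b => exact congrFun (congrArg CInftyRingHom.toFun hr) b
  | op f s ih => rw [← op_mk, φ.map_op, ψ.map_op, funext ih]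

end CInftyCoprod

/-! # Localization and the `∞`-radical -/

namespace CInftyRing

/-- The `C^∞`-ring `A{a⁻¹}` obtained from `A` by inverting `a`: the quotient of
`A ⊗_∞ C^∞(ℝ)` by the ideal generated by `a x - 1`, where `x` is the coordinate on `ℝ`. -/
abbrev Localization {A : Type u} [CInftyRing A] (a : A) : Type u :=
  CInftyCoprod A (Smooth 1) ⧸ Ideal.span
    {(CInftyCoprod.inl A (Smooth 1)).toFun a *
      (CInftyCoprod.inr A (Smooth 1)).toFun (Smooth.proj 0) - 1}

namespace Localization

variable {A : Type u} [CInftyRing A]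

/-- The canonical morphism `A → A{a⁻¹}`. -/
noncomputable def map (a : A) : CInftyRingHom A (Localization a) :=
  (CInftyRingHom.quotientMk _).comp (CInftyCoprod.inl A (Smooth 1))

theorem isUnit (a : A) : IsUnit ((map a).toFun a) := by
  refine IsUnit.of_mul_eq_one (Ideal.Quotient.mk _
    ((CInftyCoprod.inr A (Smooth 1)).toFun (Smooth.proj 0))) ?_
  have h := Ideal.Quotient.eq.2 (Ideal.subset_span (Set.mem_singleton
    ((CInftyCoprod.inl A (Smooth 1)).toFun a *
      (CInftyCoprod.inr A (Smooth 1)).toFun (Smooth.proj 0) - 1)))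
  rw [map_mul, map_one] at h
  exact h

theorem exists_lift {B : Type v} [CInftyRing B] (a : A) (φ : CInftyRingHom A B)
    (h : IsUnit (φ.toFun a)) :
    ∃ ψ : CInftyRingHom (Localization a) B, ψ.comp (map a) = φ := by
  obtain ⟨y, hy⟩ := h.exists_right_inv
  refine ⟨CInftyRingHom.lift _ (CInftyCoprod.desc φ (CInftyRingHom.eval ![y])) ?_, rfl⟩
  rw [Ideal.span_le, Set.singleton_subset_iff, SetLike.mem_coe, RingHom.mem_ker, map_sub, map_mul,
    map_one, sub_eq_zero]
  refine Eq.trans ?_ hy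
  exact congrArg (φ.toFun a * ·) (op_proj 0 ![y])

/-- `A{a⁻¹}` is trivial if and only if `A` has no nontrivial target in which `a` is invertible. -/
theorem subsingleton_of_hom {B : Type v} [CInftyRing B] (a : A) (φ : CInftyRingHom A B)
    (h : IsUnit (φ.toFun a)) (hs : Subsingleton (Localization a)) : Subsingleton B := by
  obtain ⟨ψ, -⟩ := exists_lift a φ h
  refine subsingleton_of_zero_eq_one ?_
  rw [← map_one ψ.toRingHom, ← map_zero ψ.toRingHom]
  exact congrArg _ (Subsingleton.elim _ _)

/-- The `C^∞`-ring of all functions on a set. -/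
@[reducible] def functions (T : Type u) : CInftyRing (T → ℝ) where
  op f g t := f.1 fun i => g i t
  op_proj _ _ := rfl
  op_comp _ _ _ := rfl
  op_addFn _ := rfl
  op_mulFn _ := rfl

theorem subsingleton_of_relation (f : A) {n : ℕ} (a : Fin n → A) (E F : Smooth n)
    (hE : op E a = f) (hF : op F a = 0) (h : ∀ x, F.1 x = 0 → E.1 x = 0) :
    Subsingleton (Localization f) := by
  obtain ⟨y, hy⟩ := (isUnit f).exists_right_inv
  let b : Fin (n + 1) → Localization f := Fin.snoc (fun i => (map f).toFun (a i)) y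
  let E' : Smooth (n + 1) := Smooth.comp E fun i => Smooth.proj i.castSucc
  let F' : Smooth (n + 1) := Smooth.comp F fun i => Smooth.proj i.castSucc
  let H : Smooth (n + 1) := F' * F' + (E' * Smooth.proj (Fin.last n) - 1) *
    (E' * Smooth.proj (Fin.last n) - 1)
  have hH : ∀ v, H.1 v ≠ 0 := fun v hv => by
    have h1 : F'.1 v * F'.1 v + (E'.1 v * v (Fin.last n) - 1) * (E'.1 v * v (Fin.last n) - 1) = 0 :=
      hv
    have h2 : F'.1 v = 0 := by nlinarith [mul_self_nonneg (E'.1 v * v (Fin.last n) - 1)]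
    have h3 : E'.1 v = 0 := h _ h2
    rw [h2, h3] at h1
    norm_num at h1
  let K : Smooth (n + 1) := ⟨fun v => (H.1 v)⁻¹,
    show ContDiff ℝ ∞ fun v => (H.1 v)⁻¹ from H.contDiff.inv hH⟩
  have hHK : H * K = 1 := Subtype.ext (funext fun v => mul_inv_cancel₀ (hH v))
  have hE' : eval b E' = (map f).toFun f := by
    refine Eq.trans ?_ (((map f).map_op E a).symm.trans (congrArg (map f).toFun hE))
    refine (op_comp _ _ _).trans (congrArg (op E) (funext fun i => (op_proj _ _).trans ?_))
    exact Fin.snoc_castSucc (α := fun _ => Localization f) _ _ _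
  have hF' : eval b F' = 0 := by
    refine Eq.trans ?_ (((map f).map_op F a).symm.trans
      ((congrArg (map f).toFun hF).trans (map_zero (map f).toRingHom)))
    refine (op_comp _ _ _).trans (congrArg (op F) (funext fun i => (op_proj _ _).trans ?_))
    exact Fin.snoc_castSucc (α := fun _ => Localization f) _ _ _
  have hy' : eval b (Smooth.proj (Fin.last n)) = y :=
    (op_proj _ _).trans (Fin.snoc_last (α := fun _ => Localization f) _ _)
  have := congrArg (eval b) hHK
  simp only [H, map_mul, map_add, map_sub, map_one, hE', hF', hy', hy] at this
  refine subsingleton_of_zero_eq_one ?_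
  rw [← this]
  ring

theorem exists_relation (f : A) (hs : Subsingleton (Localization f)) :
    ∃ (n : ℕ) (a : Fin n → A) (E F : Smooth n), op E a = f ∧ op F a = 0 ∧
      ∀ x, F.1 x = 0 → E.1 x = 0 := by
  classical
  let T : Type u := {v : A → ℝ // v f ≠ 0}
  let _ : CInftyRing (T → ℝ) := functions T
  let K : Ideal (T → ℝ) := Ideal.span {g | ∃ (n : ℕ) (a : Fin n → A) (F : Smooth n),
    op F a = 0 ∧ g = fun v => F.1 fun i => v.1 (a i)}
  let x : A → T → ℝ := fun a v => v.1 a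
  let φ : CInftyRingHom A ((T → ℝ) ⧸ K) := ⟨fun a => Ideal.Quotient.mk K (x a), fun {n} G a => by
    rw [op_mk]
    refine Ideal.Quotient.eq.2 (Ideal.subset_span ⟨n + 1, Fin.snoc a (op G a),
      Smooth.proj (Fin.last n) - Smooth.comp G fun i => Smooth.proj i.castSucc, ?_, ?_⟩)
    · refine (map_sub (eval (Fin.snoc a (op G a) : Fin (n + 1) → A)) _ _).trans
        (sub_eq_zero.2 ?_)
      refine (op_proj _ _).trans ((Fin.snoc_last (α := fun _ => A) _ _).trans ?_)
      refine ((op_comp _ _ _).trans (congrArg (op G) (funext fun i => ?_))).symm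
      exact (op_proj _ _).trans (Fin.snoc_castSucc (α := fun _ => A) _ _ _)
    · funext v
      change v.1 (op G a) - G.1 (fun i => v.1 (a i)) =
        v.1 ((Fin.snoc a (op G a) : Fin (n + 1) → A) (Fin.last n)) -
          G.1 fun i => v.1 ((Fin.snoc a (op G a) : Fin (n + 1) → A) i.castSucc)
      simp only [Fin.snoc_last, Fin.snoc_castSucc]⟩
  have hu : IsUnit (φ.toFun f) := by
    refine IsUnit.map (Ideal.Quotient.mk K) (IsUnit.of_mul_eq_one (fun v : T => (v.1 f)⁻¹) ?_)
    funext v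
    exact mul_inv_cancel₀ v.2
  have htriv := subsingleton_of_hom f φ hu hs
  have hone : (1 : T → ℝ) ∈ K := by
    rw [← Ideal.Quotient.eq_zero_iff_mem]
    exact Subsingleton.elim _ _
  have key : ∀ g ∈ K, ∃ (n : ℕ) (a : Fin n → A) (F : Smooth n), op F a = 0 ∧
      ∀ v : T, F.1 (fun i => v.1 (a i)) = 0 → g v = 0 := fun g hg => by
    refine Submodule.span_induction ?_ ?_ ?_ ?_ hg
    · rintro g ⟨n, a, F, hF, rfl⟩
      exact ⟨n, a, F, hF, fun v hv => hv⟩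
    · exact ⟨0, ![], 0, op_zero _, fun v _ => rfl⟩
    · rintro g g' - - ⟨n, a, F, hF, h⟩ ⟨m, b, G, hG, h'⟩
      let F' : Smooth (n + m) := Smooth.comp F fun i => Smooth.proj (Fin.castAdd m i)
      let G' : Smooth (n + m) := Smooth.comp G fun i => Smooth.proj (Fin.natAdd n i)
      refine ⟨n + m, Fin.append a b, F' * F' + G' * G', ?_, fun v hv => ?_⟩
      · simp only [F', G', op_add, op_mul, op_comp, op_proj, Fin.append_left, Fin.append_right,
          hF, hG, mul_zero, add_zero]
      · have e : F.1 (fun i => v.1 (a i)) * F.1 (fun i => v.1 (a i)) +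
            G.1 (fun i => v.1 (b i)) * G.1 (fun i => v.1 (b i)) = 0 := by
          refine Eq.trans ?_ hv
          change _ = F.1 (fun i => v.1 (Fin.append a b (Fin.castAdd m i))) *
            F.1 (fun i => v.1 (Fin.append a b (Fin.castAdd m i))) +
            G.1 (fun i => v.1 (Fin.append a b (Fin.natAdd n i))) *
            G.1 (fun i => v.1 (Fin.append a b (Fin.natAdd n i)))
          simp only [Fin.append_left, Fin.append_right]
        obtain ⟨h1, h2⟩ := mul_self_add_mul_self_eq_zero.1 e
        change g v + g' v = 0
        rw [h v h1, h' v h2, add_zero]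
    · rintro r g - ⟨n, a, F, hF, h⟩
      refine ⟨n, a, F, hF, fun v hv => ?_⟩
      change r v * g v = 0
      rw [h v hv, mul_zero]
  obtain ⟨n, a, F, hF, h⟩ := key 1 hone
  let b : Fin (n + 1) → A := Fin.cons f a
  let D : Fin (n + 1) → Fin (n + 1) → Smooth (n + 1) := fun i j =>
    if b i = b j then (Smooth.proj i - Smooth.proj j) * (Smooth.proj i - Smooth.proj j) else 0
  let F' : Smooth (n + 1) := Smooth.comp F fun i => Smooth.proj i.succ
  refine ⟨n + 1, b, Smooth.proj 0, F' * F' + ∑ i, ∑ j, D i j, op_proj _ _, ?_, fun x hx => ?_⟩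
  · have hD : ∀ i j, eval b (D i j) = 0 := fun i j => by
      by_cases hij : b i = b j
      · have : eval b (Smooth.proj i - Smooth.proj j) = 0 := by
          rw [map_sub]
          exact sub_eq_zero.2 ((op_proj _ _).trans (hij.trans (op_proj _ _).symm))
        simp only [D, if_pos hij, map_mul, this, mul_zero]
      · simp only [D, if_neg hij, map_zero]
    have hF' : eval b F' = 0 := by
      refine Eq.trans ?_ hF
      exact (op_comp _ _ _).trans (congrArg (op F) (funext fun i => op_proj _ _))
    change eval b _ = 0
    rw [map_add, map_mul, hF', map_sum]
    simp only [map_sum, hD, Finset.sum_const_zero, mul_zero, add_zero]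
  · by_contra hx0
    have hDx : ∀ i j, (D i j).1 x = if b i = b j then (x i - x j) * (x i - x j) else 0 :=
      fun i j => by
        by_cases hij : b i = b j
        · simp only [D, if_pos hij]; rfl
        · simp only [D, if_neg hij]; rfl
    have hD0 : ∀ i j, 0 ≤ (D i j).1 x := fun i j => by
      rw [hDx]
      split_ifs
      exacts [mul_self_nonneg _, le_rfl]
    have hx' : F'.1 x * F'.1 x + ∑ i, ∑ j, (D i j).1 x = 0 := by
      rw [← hx]
      change _ = F'.1 x * F'.1 x + (∑ i, ∑ j, D i j : Smooth (n + 1)).1 x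
      simp only [AddSubmonoidClass.coe_finsetSum, Finset.sum_apply]
    have hs0 : 0 ≤ ∑ i, ∑ j, (D i j).1 x :=
      Finset.sum_nonneg fun i _ => Finset.sum_nonneg fun j _ => hD0 i j
    have hFx : F'.1 x = 0 := by nlinarith [mul_self_nonneg (F'.1 x)]
    rw [hFx, mul_zero, zero_add] at hx'
    have hz : ∀ i j, (D i j).1 x = 0 := fun i j =>
      (Finset.sum_eq_zero_iff_of_nonneg fun j _ => hD0 i j).1
        ((Finset.sum_eq_zero_iff_of_nonneg fun i _ => Finset.sum_nonneg fun j _ => hD0 i j).1 hx' i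
          (Finset.mem_univ i)) j (Finset.mem_univ j)
    have heq : ∀ i j, b i = b j → x i = x j := fun i j hij => by
      have := hz i j
      rw [hDx, if_pos hij] at this
      exact sub_eq_zero.1 (mul_self_eq_zero.1 this)
    let v : A → ℝ := fun c => if hc : ∃ i, b i = c then x hc.choose else 0
    have hv : ∀ i, v (b i) = x i := fun i => by
      have hc : ∃ j, b j = b i := ⟨i, rfl⟩
      simp only [v, dif_pos hc]
      exact heq _ _ hc.choose_spec
    have hvf : v f ≠ 0 := by
      have := hv 0
      rw [show b 0 = f from rfl] at this
      rwa [this]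
    refine one_ne_zero (α := ℝ) (h ⟨v, hvf⟩ (Eq.trans ?_ hFx))
    exact congrArg F.1 (funext fun i => hv i.succ)

end Localization

/-- The `∞`-radical of an ideal `I`: the ideal of all `f` with `(A/I){f⁻¹} = 0`. -/
noncomputable def inftyRadical {A : Type u} [CInftyRing A] (I : Ideal A) : Ideal A where
  carrier := {f | Subsingleton (Localization (Ideal.Quotient.mk I f))}
  zero_mem' := Localization.subsingleton_of_relation _ ![] 0 0
    ((op_zero _).trans (map_zero _).symm) (op_zero _) fun _ _ => rfl
  add_mem' {f g} hf hg := by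
    obtain ⟨n, a, E, F, hE, hF, h⟩ := Localization.exists_relation _ hf
    obtain ⟨m, b, E', F', hE', hF', h'⟩ := Localization.exists_relation _ hg
    let L : Smooth n → Smooth (n + m) := fun G => Smooth.comp G fun i =>
      Smooth.proj (Fin.castAdd m i)
    let R : Smooth m → Smooth (n + m) := fun G => Smooth.comp G fun i =>
      Smooth.proj (Fin.natAdd n i)
    refine Localization.subsingleton_of_relation _ (Fin.append a b) (L E + R E')
      (L F * L F + R F' * R F') ?_ ?_ fun x hx => ?_
    · simp only [L, R, op_add, op_comp, op_proj, Fin.append_left, Fin.append_right, hE, hE',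
        map_add]
    · simp only [L, R, op_add, op_mul, op_comp, op_proj, Fin.append_left, Fin.append_right, hF,
        hF', mul_zero, add_zero]
    · obtain ⟨h1, h2⟩ := mul_self_add_mul_self_eq_zero.1
        (show (L F).1 x * (L F).1 x + (R F').1 x * (R F').1 x = 0 from hx)
      change (L E).1 x + (R E').1 x = 0
      rw [show (L E).1 x = 0 from h _ h1, show (R E').1 x = 0 from h' _ h2, add_zero]
  smul_mem' c f hf := by
    obtain ⟨n, a, E, F, hE, hF, h⟩ := Localization.exists_relation _ hf
    let L : Smooth n → Smooth (n + 1) := fun G => Smooth.comp G fun i =>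
      Smooth.proj i.castSucc
    refine Localization.subsingleton_of_relation _
      (Fin.snoc a (Ideal.Quotient.mk I c) : Fin (n + 1) → A ⧸ I)
      (Smooth.proj (Fin.last n) * L E) (L F) ?_ ?_ fun x hx => ?_
    · simp only [L, op_mul, op_comp, op_proj, Fin.snoc_castSucc, Fin.snoc_last, hE, smul_eq_mul,
        map_mul]
    · simp only [L, op_comp, op_proj, Fin.snoc_castSucc, hF]
    · change x (Fin.last n) * (L E).1 x = 0
      rw [show (L E).1 x = 0 from h _ hx, mul_zero]

theorem mem_inftyRadical {A : Type u} [CInftyRing A] {I : Ideal A} {f : A} :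
    f ∈ inftyRadical I ↔ Subsingleton (Localization (Ideal.Quotient.mk I f)) := Iff.rfl

end CInftyRing

namespace CInftyRing

variable {A : Type u} {B : Type v} [CInftyRing A] [CInftyRing B]

theorem radical_le_comap (φ : CInftyRingHom A B) (I : Ideal A) (J : Ideal B)
    (h : I ≤ J.comap φ.toRingHom) : I.radical ≤ J.radical.comap φ.toRingHom :=
  fun a ⟨n, hn⟩ => ⟨n, by rw [← map_pow]; exact h hn⟩

theorem inftyRadical_le_comap (φ : CInftyRingHom A B) (I : Ideal A) (J : Ideal B)
    (h : I ≤ J.comap φ.toRingHom) : inftyRadical I ≤ (inftyRadical J).comap φ.toRingHom :=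
  fun a ha => Localization.subsingleton_of_hom (Ideal.Quotient.mk I a)
    ((Localization.map (Ideal.Quotient.mk J (φ.toFun a))).comp
      (CInftyRingHom.quotientMap I J φ h))
    (Localization.isUnit (Ideal.Quotient.mk J (φ.toFun a))) ha

end CInftyRing

/-! # The category of `C^∞`-rings, `C^∞`-schemes and reductions -/

open CategoryTheory CategoryTheory.Limits

/-- The category of `C^∞`-rings. -/
structure CInftyRingCat : Type (u + 1) where
  /-- The bundled `C^∞`-ring with a given underlying type. -/
  of ::
  /-- The underlying type. -/
  carrier : Type u
  [str : CInftyRing carrier]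

attribute [instance] CInftyRingCat.str

instance : Category.{u} CInftyRingCat.{u} where
  Hom A B := CInftyRingHom A.carrier B.carrier
  id A := CInftyRingHom.id A.carrier
  comp φ ψ := CInftyRingHom.comp ψ φ

/-- `A ⊗_∞ B` is the coproduct of `A` and `B` in the category of `C^∞`-rings. -/
theorem CInftyCoprod.nonempty_isColimit (A B : Type u) [CInftyRing A] [CInftyRing B] :
    Nonempty (IsColimit (BinaryCofan.mk (X := CInftyRingCat.of A) (Y := CInftyRingCat.of B)
      (P := CInftyRingCat.of (CInftyCoprod A B)) (CInftyCoprod.inl A B)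
      (CInftyCoprod.inr A B))) :=
  ⟨BinaryCofan.IsColimit.mk _ (fun φ ψ => CInftyCoprod.desc φ ψ)
    (fun φ ψ => CInftyCoprod.desc_inl φ ψ) (fun φ ψ => CInftyCoprod.desc_inr φ ψ)
    fun φ ψ _ h₁ h₂ => CInftyCoprod.hom_ext (h₁.trans (CInftyCoprod.desc_inl φ ψ).symm)
      (h₂.trans (CInftyCoprod.desc_inr φ ψ).symm)⟩

/-- The category of `C^∞`-schemes: the opposite of the category of `C^∞`-rings. -/
abbrev CInftyScheme : Type (u + 1) := CInftyRingCat.{u}ᵒᵖ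

/-- The functor `red_n`: the quotient by the nilradical of `0`. -/
noncomputable def nilReduction : CInftyRingCat.{u} ⥤ CInftyRingCat.{u} where
  obj A := .of (A.carrier ⧸ (⊥ : Ideal A.carrier).radical)
  map φ := CInftyRingHom.quotientMap _ _ φ (CInftyRing.radical_le_comap φ _ _ bot_le)
  map_id _ := CInftyRingHom.quotient_ext fun _ => rfl
  map_comp _ _ := CInftyRingHom.quotient_ext fun _ => rfl

/-- The projections `A → red_n(A)`. -/
noncomputable def nilReductionUnit : 𝟭 CInftyRingCat.{u} ⟶ nilReduction where
  app A := CInftyRingHom.quotientMk (⊥ : Ideal A.carrier).radical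

/-- The functor `red_∞`: the quotient by the `∞`-radical of `0`. -/
noncomputable def inftyReduction : CInftyRingCat.{u} ⥤ CInftyRingCat.{u} where
  obj A := .of (A.carrier ⧸ CInftyRing.inftyRadical (⊥ : Ideal A.carrier))
  map φ := CInftyRingHom.quotientMap _ _ φ (CInftyRing.inftyRadical_le_comap φ _ _ bot_le)
  map_id _ := CInftyRingHom.quotient_ext fun _ => rfl
  map_comp _ _ := CInftyRingHom.quotient_ext fun _ => rfl

/-- The projections `A → red_∞(A)`. -/
noncomputable def inftyReductionUnit : 𝟭 CInftyRingCat.{u} ⟶ inftyReduction where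
  app A := CInftyRingHom.quotientMk (CInftyRing.inftyRadical (⊥ : Ideal A.carrier))

/-- Given a functor `F` on `C^∞`-rings with a natural map `η : id → F`, a `C^∞`-scheme `X` is
`F`-injective if every morphism `C^∞(X) → F(R)` lifts along `η : R → F(R)`. -/
def IsInjectiveFor (F : CInftyRingCat.{u} ⥤ CInftyRingCat.{u}) (η : 𝟭 CInftyRingCat.{u} ⟶ F)
    (X : CInftyScheme.{u}) : Prop :=
  ∀ (R : CInftyRingCat.{u}) (φ : X.unop ⟶ F.obj R), ∃ ψ : X.unop ⟶ R, ψ ≫ η.app R = φ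

/-- The presheaf `P ∘ F`, for a presheaf `P` on `C^∞`-schemes and a functor `F` on `C^∞`-rings. -/
def deRhamSpace (F : CInftyRingCat.{u} ⥤ CInftyRingCat.{u}) (P : CInftyScheme.{u}ᵒᵖ ⥤ Type u) :
    CInftyScheme.{u}ᵒᵖ ⥤ Type u :=
  F.op.op ⋙ P

/-- The canonical morphism `P → P ∘ F` induced by `η : id → F`. -/
def toDeRhamSpace {F : CInftyRingCat.{u} ⥤ CInftyRingCat.{u}} (η : 𝟭 CInftyRingCat.{u} ⟶ F)
    (P : CInftyScheme.{u}ᵒᵖ ⥤ Type u) : P ⟶ deRhamSpace F P where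
  app Y := P.map (η.app Y.unop.unop).op.op
  naturality Y Z f := by
    change P.map f ≫ P.map _ = P.map _ ≫ P.map _
    rw [← P.map_comp, ← P.map_comp]
    exact congrArg (fun g => P.map (Quiver.Hom.op (Quiver.Hom.op g))) (η.naturality f.unop.unop)

/-! # Infinitesimal neighbourhoods of the diagonal -/

namespace CInftyScheme

variable (X : CInftyScheme.{u})

/-- The `C^∞`-ring `C^∞(X × X) = C^∞(X) ⊗_∞ C^∞(X)`. -/
abbrev SquareRing : Type u := CInftyCoprod X.unop.carrier X.unop.carrier

/-- The ideal of the diagonal: the kernel of the codiagonal `C^∞(X × X) → C^∞(X)`. -/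
noncomputable def diagonalIdeal : Ideal (SquareRing X) :=
  RingHom.ker (CInftyCoprod.desc (CInftyRingHom.id X.unop.carrier)
    (CInftyRingHom.id X.unop.carrier)).toRingHom

variable (rad : Ideal (SquareRing X) → Ideal (SquareRing X))

/-- The set of ideals of `C^∞(X × X)` having the same radical as the ideal of the diagonal, for a
given notion of radical, ordered by inclusion. -/
abbrev NeighborhoodIdeal : Type u := {I : Ideal (SquareRing X) // rad I = rad (diagonalIdeal X)}

/-- The diagram of quotients `C^∞(X × X)/I`, for an inclusion `I ≤ J` the map being the
projection `C^∞(X × X)/I → C^∞(X × X)/J`. -/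
noncomputable def neighborhoodRings : NeighborhoodIdeal X rad ⥤ CInftyRingCat.{u} where
  obj I := .of (SquareRing X ⧸ I.1)
  map f := CInftyRingHom.quotientMap _ _ (CInftyRingHom.id _) (leOfHom f)
  map_id _ := CInftyRingHom.quotient_ext fun _ => rfl
  map_comp _ _ := CInftyRingHom.quotient_ext fun _ => rfl

/-- The diagram of representable presheaves of the closed subschemes
`Spec (C^∞(X × X)/I) ⊆ X × X`. -/
noncomputable def neighborhoodDiagram :
    (NeighborhoodIdeal X rad)ᵒᵖ ⥤ (CInftyScheme.{u}ᵒᵖ ⥤ Type u) :=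
  (neighborhoodRings X rad).op ⋙ yoneda

/-- The infinitesimal neighbourhood of the diagonal: the colimit, in presheaves on `C^∞`-schemes,
of the representable presheaves of `Spec (C^∞(X × X)/I)`. -/
noncomputable def diagonalNeighborhood : CInftyScheme.{u}ᵒᵖ ⥤ Type u :=
  colimit (neighborhoodDiagram X rad)

/-- The morphism from the neighbourhood of the diagonal to `X` which restricts on each
`Spec (C^∞(X × X)/I)` to the morphism given by `C^∞(X) → C^∞(X × X) → C^∞(X × X)/I`. -/
noncomputable def neighborhoodProj (ι : CInftyRingHom X.unop.carrier (SquareRing X)) :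
    diagonalNeighborhood X rad ⟶ yoneda.obj X :=
  colimit.desc (neighborhoodDiagram X rad)
    { pt := yoneda.obj X
      ι :=
        { app := fun I => yoneda.map
            (Quiver.Hom.op ((CInftyRingHom.quotientMk I.unop.1).comp ι :
              X.unop ⟶ (neighborhoodRings X rad).obj I.unop))
          naturality := fun I J f => by
            change yoneda.map _ ≫ yoneda.map _ = yoneda.map _ ≫ 𝟙 _
            rw [Category.comp_id, ← yoneda.map_comp]
            rfl } }

/-- The first projection from the neighbourhood of the diagonal to `X`. -/
noncomputable def neighborhoodFst : diagonalNeighborhood X rad ⟶ yoneda.obj X :=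
  neighborhoodProj X rad (CInftyCoprod.inl _ _)

/-- The second projection from the neighbourhood of the diagonal to `X`. -/
noncomputable def neighborhoodSnd : diagonalNeighborhood X rad ⟶ yoneda.obj X :=
  neighborhoodProj X rad (CInftyCoprod.inr _ _)

end CInftyScheme

/-!
In presheaves of sets coequalizers are computed pointwise, so let `R` be a `C^∞`-ring and consider
the map `Hom(C^∞(X), R) → Hom(C^∞(X), red R)`. Injectivity of `X` says that it is surjective. It is
therefore the quotient by its kernel pair, and it has to be shown that this is the image of `N(R)`:
for `χ : C^∞(X × X) → R` with kernel `K`, the two components of `χ` agree in `red R` if and only if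
`K` contains an ideal `I` with the same radical as the ideal `𝔪_Δ` of the diagonal.

The components agree in `red R` if and only if `𝔪_Δ ≤ χ⁻¹(√0)`
(`CInftyScheme.diagonalIdeal_le_comap_iff`). If the radical commutes with preimages, this reads
`𝔪_Δ ≤ √K`. If it is also idempotent and commutes with binary intersections, then
`𝔪_Δ ⊓ K` is an ideal `I` as required (`CInftyScheme.exists_neighborhoodIdeal_le_iff`).

For the nilradical these properties are standard. For the `∞`-radical they follow from the criterion
`CInftyRing.mem_inftyRadical_iff`: `x ∈ √I` if and only if `G(x) ∈ I` for a smooth function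
`G : ℝ → ℝ` which vanishes at the origin only. Indeed, triviality of the localization yields a
relation `F(a) = 0` in `A/I`, with `E(a) = x` for a smooth function `E` that vanishes where `F`
does; and there is a `G` so flat at the origin that `F` divides `G ∘ E`
(`exists_contDiff_comp_eq_mul`).
-/

/-! ### Divisibility of smooth functions -/

/-- A sequence of smooth functions on a finite-dimensional space can be scaled to have a smooth sum:
any nonnegative coefficients below suitable positive bounds will do. -/
theorem exists_pos_forall_contDiff_tsum {E : Type*} [NormedAddCommGroup E] [NormedSpace ℝ E]
    [FiniteDimensional ℝ E] (f : ℕ → E → ℝ) (hf : ∀ i, ContDiff ℝ ∞ (f i)) :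
    ∃ ε : ℕ → ℝ, (∀ i, 0 < ε i) ∧ ∀ c : ℕ → ℝ, (∀ i, 0 ≤ c i) → (∀ i, c i ≤ ε i) →
      (∀ x, Summable fun i => c i * f i x) ∧ ContDiff ℝ ∞ fun x => ∑' i, c i * f i x := by
  -- The cutoff `β k` equals `1` on the ball of radius `k + 1`. As `β k * f i` has compact support,
  -- its derivatives are bounded.
  let β (k : ℕ) : ContDiffBump (0 : E) :=
    { rIn := k + 1, rOut := k + 2, rIn_pos := by positivity, rIn_lt_rOut := by linarith }
  have hβf : ∀ i k, ContDiff ℝ ∞ fun x => β k x * f i x := fun i k =>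
    (β k).contDiff.mul (hf i)
  have hbound : ∀ i k m : ℕ, ∃ C, ∀ x, ‖iteratedFDeriv ℝ m (fun x => β k x * f i x) x‖ ≤ C :=
    fun i k m => ((hβf i k).continuous_iteratedFDeriv
      (by exact_mod_cast le_top)).bounded_above_of_compact_support
        ((β k).hasCompactSupport.mul_right.iteratedFDeriv m)
  choose C hC using hbound
  -- `B i` bounds the derivatives of `β k * f i` of order `m`, for all `k, m ≤ i`.
  let B : ℕ → ℝ := fun i =>
    1 + ∑ k ∈ Finset.range (i + 1), ∑ m ∈ Finset.range (i + 1), |C i k m|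
  have hB : ∀ i, 0 < B i := fun i => by positivity
  have hCB : ∀ {i k m}, k ≤ i → m ≤ i → C i k m ≤ B i := fun {i k m} hk hm => by
    have h₁ := Finset.single_le_sum (f := fun m => |C i k m|) (fun _ _ => abs_nonneg _)
      (Finset.mem_range_succ_iff.2 hm)
    have h₂ := Finset.single_le_sum
      (f := fun k => ∑ m ∈ Finset.range (i + 1), |C i k m|)
      (fun _ _ => Finset.sum_nonneg fun _ _ => abs_nonneg _) (Finset.mem_range_succ_iff.2 hk)
    have h₃ := le_abs_self (C i k m)
    simp only [B] at *
    linarith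
  refine ⟨fun i => (1 / 2) ^ i / B i, fun i => div_pos (by positivity) (hB i),
    fun c hc hcε => ?_⟩
  have hle : ∀ {k m i : ℕ} (x : E), k ≤ i → m ≤ i →
      ‖iteratedFDeriv ℝ m (fun x => c i * (β k x * f i x)) x‖ ≤ (1 / 2) ^ i := by
    intro k m i x hk hm
    have h : iteratedFDeriv ℝ m (fun x => c i * (β k x * f i x)) x =
        c i • iteratedFDeriv ℝ m (fun x => β k x * f i x) x :=
      iteratedFDeriv_const_smul_apply (a := c i) (f := fun x => β k x * f i x)
        ((hβf i k).contDiffAt.of_le (by exact_mod_cast le_top))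
    rw [h, norm_smul, Real.norm_of_nonneg (hc i)]
    calc c i * _ ≤ (1 / 2) ^ i / B i * B i :=
          mul_le_mul (hcε i) ((hC i k m x).trans (hCB hk hm)) (norm_nonneg _)
            (div_nonneg (by positivity) (hB i).le)
      _ = _ := div_mul_cancel₀ _ (hB i).ne'
  have hgeom : Summable fun i : ℕ => (1 / 2 : ℝ) ^ i := summable_geometric_two
  have hball : ∀ {k : ℕ} {x : E}, ‖x‖ ≤ k + 1 → β k x = 1 := fun {k x} hx =>
    (β k).one_of_mem_closedBall (by simpa [β] using hx)
  constructor
  · intro x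
    obtain ⟨k, hk⟩ := exists_nat_ge ‖x‖
    refine Summable.of_norm_bounded_eventually_nat hgeom ?_
    filter_upwards [Filter.eventually_ge_atTop k] with i hi
    have := hle (m := 0) x hi (Nat.zero_le i)
    rwa [norm_iteratedFDeriv_zero, hball (by linarith), one_mul] at this
  · -- Near a given point the series agrees with the series of the `c i * (β k * f i)`, for `k` large.
    refine contDiff_iff_contDiffAt.2 fun x => ?_
    obtain ⟨k, hk⟩ := exists_nat_ge ‖x‖
    have hsum : ContDiff ℝ ∞ fun x => ∑' i, c i * (β k x * f i x) := by
      refine contDiff_tsum_of_eventually (v := fun _ i => (1 / 2) ^ i)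
        (fun i => contDiff_const.mul (hβf i k)) (fun _ _ => hgeom) fun m _ => ?_
      rw [Nat.cofinite_eq_atTop]
      filter_upwards [Filter.eventually_ge_atTop (max k m)] with i hi y
      exact hle y ((le_max_left _ _).trans hi) ((le_max_right _ _).trans hi)
    refine hsum.contDiffAt.congr_of_eventuallyEq ?_
    filter_upwards [Metric.ball_mem_nhds x one_pos] with y hy
    have hy' : ‖y‖ ≤ k + 1 := by
      have h₁ : ‖y - x‖ < 1 := by rwa [← dist_eq_norm]
      have h₂ := norm_le_norm_add_norm_sub' y x
      linarith
    simp only [hball hy', one_mul]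

/-- If the zeros of `f` are zeros of `e`, then `f` divides `g ∘ e` for some smooth `g : ℝ → ℝ` that
vanishes at the origin only. The function `g` is the sum of a series `∑ cᵢ χᵢ`, where `χᵢ` is zero
near the origin, so that each `χᵢ(e) / f` is smooth. For `cᵢ` small enough the series `∑ cᵢ χᵢ` and
`∑ cᵢ χᵢ(e) / f` both have smooth sums. -/
theorem exists_contDiff_comp_eq_mul {E : Type*} [NormedAddCommGroup E] [NormedSpace ℝ E]
    [FiniteDimensional ℝ E] {e f : E → ℝ} (he : ContDiff ℝ ∞ e) (hf : ContDiff ℝ ∞ f)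
    (hef : ∀ x, f x = 0 → e x = 0) :
    ∃ g : ℝ → ℝ, ContDiff ℝ ∞ g ∧ (∀ t, g t = 0 ↔ t = 0) ∧
      ∃ h : E → ℝ, ContDiff ℝ ∞ h ∧ ∀ x, g (e x) = h x * f x := by
  let δ : ℕ → ℝ := fun i => 1 / ((i : ℝ) + 1)
  -- `χ i` is positive for `t ^ 2 > δ i` and zero elsewhere.
  let χ : ℕ → ℝ → ℝ := fun i t => expNegInvGlue (t ^ 2 - δ i)
  have hχ : ∀ i, ContDiff ℝ ∞ (χ i) := fun i =>
    expNegInvGlue.contDiff.comp ((contDiff_id.pow 2).sub contDiff_const)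
  have hχe : ∀ i, ContDiff ℝ ∞ fun x => χ i (e x) / f x := fun i => by
    refine contDiff_iff_contDiffAt.2 fun x => ?_
    by_cases hx : f x = 0
    · refine (contDiffAt_const (c := (0 : ℝ))).congr_of_eventuallyEq ?_
      have hlt : e x ^ 2 < δ i := by rw [hef x hx, zero_pow two_ne_zero]; positivity
      have hev : ∀ᶠ y in nhds x, e y ^ 2 < δ i :=
        (he.continuous.pow 2).continuousAt.eventually_lt_const hlt
      filter_upwards [hev] with y hy
      simp only [χ, expNegInvGlue.zero_of_nonpos (sub_nonpos.2 hy.le), zero_div]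
    · exact ((hχ i).comp he).contDiffAt.div hf.contDiffAt hx
  obtain ⟨ε₁, hε₁, h₁⟩ := exists_pos_forall_contDiff_tsum χ hχ
  obtain ⟨ε₂, hε₂, h₂⟩ := exists_pos_forall_contDiff_tsum _ hχe
  let c : ℕ → ℝ := fun i => min (ε₁ i) (ε₂ i)
  have hc : ∀ i, 0 < c i := fun i => lt_min (hε₁ i) (hε₂ i)
  obtain ⟨hs₁, hg⟩ := h₁ c (fun i => (hc i).le) fun i => min_le_left _ _
  obtain ⟨hs₂, hh⟩ := h₂ c (fun i => (hc i).le) fun i => min_le_right _ _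
  have hχ0 : ∀ i, χ i 0 = 0 := fun i => expNegInvGlue.zero_of_nonpos (by
    rw [zero_pow two_ne_zero, zero_sub]
    exact neg_nonpos.2 (by positivity))
  refine ⟨_, hg, fun t => ⟨fun ht => ?_, ?_⟩, _, hh, fun x => ?_⟩
  · by_contra ht0
    obtain ⟨i, hi⟩ := exists_nat_one_div_lt (sq_pos_of_ne_zero ht0)
    refine (Summable.tsum_pos (hs₁ t) (fun j => ?_) i ?_).ne' ht
    · exact mul_nonneg (hc j).le (expNegInvGlue.nonneg _)
    · exact mul_pos (hc i) (expNegInvGlue.pos_of_pos (sub_pos.2 hi))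
  · rintro rfl
    simp only [hχ0, mul_zero, tsum_zero]
  · rw [← tsum_mul_right]
    refine tsum_congr fun i => ?_
    by_cases hx : f x = 0
    · rw [hx, mul_zero, hef x hx, hχ0, mul_zero]
    · rw [mul_assoc, div_mul_cancel₀ _ hx]

/-! ### The `∞`-radical -/

namespace CInftyRing

variable {A : Type u} {B : Type v} [CInftyRing A] [CInftyRing B]

/-- An element `x` lies in the `∞`-radical of `I` if and only if `G(x) ∈ I` for a smooth function `G`
of one variable which vanishes at the origin only. In contrast with `Localization.exists_relation`,
this involves no elements of `A` other than `x`, and so is insensitive to enlarging `A`. -/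
theorem mem_inftyRadical_iff {I : Ideal A} {x : A} :
    x ∈ inftyRadical I ↔ ∃ G : Smooth 1, (∀ t, G.1 t = 0 ↔ t 0 = 0) ∧ op G ![x] ∈ I := by
  constructor
  · intro hx
    obtain ⟨n, a, E, F, hE, hF, hFE⟩ := Localization.exists_relation _ (mem_inftyRadical.1 hx)
    obtain ⟨g, hg, hg0, h, hh, hgh⟩ := exists_contDiff_comp_eq_mul E.contDiff F.contDiff hFE
    let G : Smooth 1 := ⟨fun t => g (t 0), hg.comp (contDiff_apply ℝ ℝ 0)⟩
    let H : Smooth n := ⟨h, hh⟩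
    have hGHF : Smooth.comp G ![E] = H * F := Subtype.ext (funext hgh)
    refine ⟨G, fun t => hg0 _, ?_⟩
    rw [← Ideal.Quotient.eq_zero_iff_mem, ← op_mk]
    have := op_comp G ![E] a
    rw [hGHF, op_mul, hF, mul_zero] at this
    rw [this]
    refine congrArg (op G) (funext fun i => ?_)
    fin_cases i
    exact hE.symm
  · rintro ⟨G, hG, hx⟩
    refine mem_inftyRadical.2 (Localization.subsingleton_of_relation _
      (fun i => Ideal.Quotient.mk I (![x] i)) (Smooth.proj 0) G (op_proj _ _) ?_
      fun t => (hG t).1)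
    rw [op_mk, Ideal.Quotient.eq_zero_iff_mem.2 hx]

/-- The `∞`-radical commutes with preimages along arbitrary morphisms, just as the nilradical does. -/
theorem inftyRadical_comap (φ : CInftyRingHom A B) (J : Ideal B) :
    inftyRadical (J.comap φ.toRingHom) = (inftyRadical J).comap φ.toRingHom := by
  ext x
  rw [Ideal.mem_comap, mem_inftyRadical_iff, mem_inftyRadical_iff]
  refine exists_congr fun G => and_congr_right fun _ => ?_
  rw [Ideal.mem_comap]
  have : φ.toRingHom (op G ![x]) = op G ![φ.toRingHom x] :=
    (φ.map_op G ![x]).trans (congrArg (op G) (funext fun i => by fin_cases i; rfl))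
  rw [this]

theorem le_inftyRadical (I : Ideal A) : I ≤ inftyRadical I := fun x hx =>
  mem_inftyRadical_iff.2 ⟨Smooth.proj 0, fun _ => Iff.rfl, by rwa [op_proj]⟩

theorem inftyRadical_idem (I : Ideal A) : inftyRadical (inftyRadical I) = inftyRadical I := by
  refine le_antisymm (fun x hx => ?_) (le_inftyRadical _)
  obtain ⟨G, hG, hx⟩ := mem_inftyRadical_iff.1 hx
  obtain ⟨H, hH, hx⟩ := mem_inftyRadical_iff.1 hx
  refine mem_inftyRadical_iff.2 ⟨Smooth.comp H ![G], fun t => (hH _).trans (hG t), ?_⟩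
  rw [op_comp]
  convert hx using 2
  funext i
  fin_cases i
  rfl

theorem inftyRadical_inf (I J : Ideal A) :
    inftyRadical (I ⊓ J) = inftyRadical I ⊓ inftyRadical J := by
  ext x
  rw [Ideal.mem_inf]
  simp only [mem_inftyRadical_iff]
  constructor
  · rintro ⟨G, hG, hx⟩
    exact ⟨⟨G, hG, hx.1⟩, ⟨G, hG, hx.2⟩⟩
  · rintro ⟨⟨G, hG, hI⟩, ⟨H, hH, hJ⟩⟩
    refine ⟨G * H, fun t => ?_, ?_⟩
    · change G.1 t * H.1 t = 0 ↔ _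
      rw [mul_eq_zero, hG, hH, or_self]
    · rw [op_mul]
      exact ⟨I.mul_mem_right _ hI, J.mul_mem_left _ hJ⟩

end CInftyRing

/-! ### Coequalizers of presheaves and neighbourhoods of the diagonal -/

/-- In a category of presheaves of sets, a map `p` is a coequalizer of `f` and `g` as soon as it is
pointwise surjective and every pair of sections identified by `p` is of the form `(f n, g n)`: then
`N → P ×_Q P` is pointwise surjective, and `p` is the quotient by its kernel pair. -/
theorem nonempty_isColimit_cofork_of_surjective {C : Type*} [Category C] {N P Q : C ⥤ Type u}
    {f g : N ⟶ P} {p : P ⟶ Q} (w : f ≫ p = g ≫ p)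
    (hp : ∀ Y, Function.Surjective (p.app Y))
    (hfg : ∀ Y (x y : P.obj Y), p.app Y x = p.app Y y →
      ∃ n : N.obj Y, f.app Y n = x ∧ g.app Y n = y) :
    Nonempty (IsColimit (Cofork.ofπ p w)) := by
  -- The induced map `Q ⟶ s.pt` sends `q` to the value of `s.π` at an arbitrary preimage of `q`.
  choose lift hlift using hp
  have hwd : ∀ (s : Cofork f g) (Y) (x y : P.obj Y), p.app Y x = p.app Y y →
      s.π.app Y x = s.π.app Y y := by
    intro s Y x y hxy
    obtain ⟨n, rfl, rfl⟩ := hfg Y x y hxy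
    exact ConcreteCategory.congr_hom (NatTrans.congr_app s.condition Y) n
  refine ⟨Cofork.IsColimit.mk _ (fun s =>
    { app := fun Y => TypeCat.ofHom fun q => s.π.app Y (lift Y q)
      naturality := fun Y Z k => ?_ }) (fun s => ?_) fun s m hm => ?_⟩
  · ext q
    change s.π.app Z (lift Z (Q.map k q)) = s.pt.map k (s.π.app Y (lift Y q))
    rw [← NatTrans.naturality_apply]
    refine hwd s Z _ _ ?_
    rw [hlift, NatTrans.naturality_apply, hlift]
  · ext Y x
    exact hwd s Y _ _ (hlift Y _)
  · ext Y q
    change m.app Y q = s.π.app Y (lift Y q)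
    rw [← hm]
    change _ = m.app Y (p.app Y (lift Y q))
    rw [hlift]

namespace CInftyScheme

variable (X : CInftyScheme.{u}) (rad : Ideal (SquareRing X) → Ideal (SquareRing X))

/-- The coequalizer property for a general reduction functor `η : id → F`. The hypothesis `hη`
says that a pair of morphisms `C^∞(X) ⇉ R`, viewed as a morphism `χ` out of `C^∞(X × X)`, is
identified by `η` exactly when it factors through one of the closed subschemes in the
neighbourhood of the diagonal. -/
theorem nonempty_isColimit_deRhamSpace {F : CInftyRingCat.{u} ⥤ CInftyRingCat.{u}}
    {η : 𝟭 CInftyRingCat.{u} ⟶ F} (hX : IsInjectiveFor F η X)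
    (hη : ∀ (R : CInftyRingCat.{u}) (χ : CInftyRingHom (SquareRing X) R.carrier),
      (∃ I : NeighborhoodIdeal X rad, I.1 ≤ RingHom.ker χ.toRingHom) ↔
        (χ.comp (CInftyCoprod.inl _ _) : X.unop ⟶ R) ≫ η.app R =
          (χ.comp (CInftyCoprod.inr _ _) : X.unop ⟶ R) ≫ η.app R) :
    ∃ w : X.neighborhoodFst rad ≫ toDeRhamSpace η (yoneda.obj X) =
        X.neighborhoodSnd rad ≫ toDeRhamSpace η (yoneda.obj X),
      Nonempty (IsColimit (Cofork.ofπ (toDeRhamSpace η (yoneda.obj X)) w)) := by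
  have hproj : ∀ (ι : CInftyRingHom X.unop.carrier (SquareRing X)) (I),
      colimit.ι (neighborhoodDiagram X rad) I ≫ neighborhoodProj X rad ι =
        yoneda.map (Quiver.Hom.op ((CInftyRingHom.quotientMk I.unop.1).comp ι :
              X.unop ⟶ (neighborhoodRings X rad).obj I.unop)) := fun ι I =>
    colimit.ι_desc _ _
  refine ⟨?_, nonempty_isColimit_cofork_of_surjective _ (fun Y q => ?_) fun Y x y hxy => ?_⟩
  · refine colimit.hom_ext fun I => ?_
    refine ((Category.assoc _ _ _).symm.trans (congrArg (· ≫ _) (hproj _ I))).trans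
      (.trans ?_ ((congrArg (· ≫ _) (hproj _ I)).symm.trans (Category.assoc _ _ _)))
    ext Y k
    let κ : CInftyRingHom (SquareRing X ⧸ I.unop.1) Y.unop.unop.carrier := k.unop
    let χ : CInftyRingHom (SquareRing X) Y.unop.unop.carrier :=
      κ.comp (CInftyRingHom.quotientMk I.unop.1)
    have hk : I.unop.1 ≤ RingHom.ker χ.toRingHom := fun a ha => by
      change κ.toRingHom (Ideal.Quotient.mk I.unop.1 a) = 0
      rw [Ideal.Quotient.eq_zero_iff_mem.2 ha, map_zero]
    exact congrArg Quiver.Hom.op ((hη Y.unop.unop χ).1 ⟨I.unop, hk⟩)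
  · obtain ⟨ψ, hψ⟩ := hX Y.unop.unop q.unop
    exact ⟨ψ.op, congrArg Quiver.Hom.op hψ⟩
  · let χ : CInftyRingHom (SquareRing X) Y.unop.unop.carrier := CInftyCoprod.desc x.unop y.unop
    obtain ⟨I, hI⟩ := (hη Y.unop.unop χ).2 (congrArg Quiver.Hom.unop hxy)
    let k : (neighborhoodRings X rad).obj I ⟶ Y.unop.unop := CInftyRingHom.lift I.1 χ hI
    refine ⟨(colimit.ι (neighborhoodDiagram X rad) (.op I)).app Y k.op, ?_, ?_⟩
    · exact ConcreteCategory.congr_hom (NatTrans.congr_app (hproj _ (.op I)) Y) k.op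
    · exact ConcreteCategory.congr_hom (NatTrans.congr_app (hproj _ (.op I)) Y) k.op

variable {X} {rad}

/-- For an idempotent radical commuting with binary intersections, the witness is
`𝔪_Δ ⊓ K`: its radical is `rad 𝔪_Δ ⊓ rad K`, which equals `rad 𝔪_Δ` once `𝔪_Δ ≤ rad K`. -/
theorem exists_neighborhoodIdeal_le_iff (hle : ∀ I, I ≤ rad I) (hidem : ∀ I, rad (rad I) = rad I)
    (hinf : ∀ I J, rad (I ⊓ J) = rad I ⊓ rad J) (K : Ideal (SquareRing X)) :
    (∃ I : NeighborhoodIdeal X rad, I.1 ≤ K) ↔ diagonalIdeal X ≤ rad K := by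
  have hmono : ∀ {I J}, I ≤ J → rad I ≤ rad J := fun {I J} hIJ => by
    rw [← inf_eq_left.2 hIJ, hinf]
    exact inf_le_right
  refine ⟨fun ⟨I, hI⟩ => (hle _).trans (I.2.symm.le.trans (hmono hI)), fun h =>
    ⟨⟨diagonalIdeal X ⊓ K, ?_⟩, inf_le_right⟩⟩
  rw [hinf, inf_eq_left, ← hidem K]
  exact hmono h

/-- The two components `C^∞(X) ⇉ R` of a morphism out of `C^∞(X × X)` agree modulo `L` if and only
if the ideal of the diagonal is mapped into `L`. -/
theorem diagonalIdeal_le_comap_iff {R : Type v} [CInftyRing R]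
    (χ : CInftyRingHom (SquareRing X) R) (L : Ideal R) :
    diagonalIdeal X ≤ L.comap χ.toRingHom ↔
      (CInftyRingHom.quotientMk L).comp (χ.comp (CInftyCoprod.inl _ _)) =
        (CInftyRingHom.quotientMk L).comp (χ.comp (CInftyCoprod.inr _ _)) := by
  constructor
  · intro h
    refine CInftyRingHom.ext (funext fun a => Ideal.Quotient.eq.2 ?_)
    have ha : (CInftyCoprod.inl X.unop.carrier X.unop.carrier).toFun a -
        (CInftyCoprod.inr X.unop.carrier X.unop.carrier).toFun a ∈ diagonalIdeal X := by
      rw [diagonalIdeal, RingHom.mem_ker, map_sub]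
      exact sub_self a
    have := h ha
    rwa [Ideal.mem_comap, map_sub] at this
  · intro h z hz
    -- Modulo `L`, the morphism `χ` factors through the codiagonal, whose kernel contains `z`.
    have hχ : (CInftyRingHom.quotientMk L).comp χ =
        ((CInftyRingHom.quotientMk L).comp (χ.comp (CInftyCoprod.inl _ _))).comp
          (CInftyCoprod.desc (CInftyRingHom.id _) (CInftyRingHom.id _)) :=
      CInftyCoprod.hom_ext rfl h.symm
    refine (Ideal.Quotient.eq_zero_iff_mem (I := L)).1
      ((congrFun (congrArg CInftyRingHom.toFun hχ) z).trans ?_)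
    have hz' : (CInftyCoprod.desc (CInftyRingHom.id X.unop.carrier)
        (CInftyRingHom.id X.unop.carrier)).toFun z = 0 := hz
    change ((CInftyRingHom.quotientMk L).comp (χ.comp (CInftyCoprod.inl _ _))).toRingHom
      ((CInftyCoprod.desc (CInftyRingHom.id _) (CInftyRingHom.id _)).toFun z) = 0
    rw [hz', map_zero]

end CInftyScheme

theorem mainTheorem2 (X : CInftyScheme.{u}) :
    (IsInjectiveFor nilReduction nilReductionUnit X →
      ∃ w : X.neighborhoodFst Ideal.radical ≫ toDeRhamSpace nilReductionUnit (yoneda.obj X) =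
          X.neighborhoodSnd Ideal.radical ≫ toDeRhamSpace nilReductionUnit (yoneda.obj X),
        Nonempty (IsColimit
          (Cofork.ofπ (toDeRhamSpace nilReductionUnit (yoneda.obj X)) w))) ∧
    (IsInjectiveFor inftyReduction inftyReductionUnit X →
      ∃ w : X.neighborhoodFst CInftyRing.inftyRadical ≫
            toDeRhamSpace inftyReductionUnit (yoneda.obj X) =
          X.neighborhoodSnd CInftyRing.inftyRadical ≫
            toDeRhamSpace inftyReductionUnit (yoneda.obj X),
        Nonempty (IsColimit
          (Cofork.ofπ (toDeRhamSpace inftyReductionUnit (yoneda.obj X)) w))) := by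
  constructor
  · refine fun hX => X.nonempty_isColimit_deRhamSpace _ hX fun R χ => ?_
    rw [CInftyScheme.exists_neighborhoodIdeal_le_iff (fun _ => Ideal.le_radical)
      Ideal.radical_idem Ideal.radical_inf]
    have hK : (RingHom.ker χ.toRingHom).radical =
        (⊥ : Ideal R.carrier).radical.comap χ.toRingHom := (Ideal.comap_radical _ _).symm
    rw [hK]
    exact CInftyScheme.diagonalIdeal_le_comap_iff χ _
  · refine fun hX => X.nonempty_isColimit_deRhamSpace _ hX fun R χ => ?_
    rw [CInftyScheme.exists_neighborhoodIdeal_le_iff CInftyRing.le_inftyRadical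
      CInftyRing.inftyRadical_idem CInftyRing.inftyRadical_inf]
    have hK : CInftyRing.inftyRadical (RingHom.ker χ.toRingHom) =
        (CInftyRing.inftyRadical (⊥ : Ideal R.carrier)).comap χ.toRingHom :=
      CInftyRing.inftyRadical_comap χ ⊥
    rw [hK]
    exact CInftyScheme.diagonalIdeal_le_comap_iff χ _
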